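/- Let $p:\{0,1\}\to[0,1]$ be a positive Bernoulli distribution, i.e. $p(0)+p(1)=1$ and $p(0),p(1)>0$, and for a finite word $w=w_1\cdots w_n$ over $\{0,1\}$ put $\mu_p(w)=\prod_{i=1}^n p(w_i)$. Let $\alpha=a_1a_2\cdots$ be a right-infinite sequence over $\{0,1\}$ that is $p$-block-distributed: for every $n\ge 1$ and every $w\in\{0,1\}^n$, $$\lim_{k\to\infty}\frac{\left|\{1\le r\le k : a_{n(r-1)+1}a_{n(r-1)+2}\cdots a_{nr}=w\}\right|}{k}=\mu_p(w).$$ Let $A$ be a deterministic finite automaton over $\{0,1\}$ with at least one accepting state, which is strongly connected, i.e. in the directed graph whose nodes are the states of $A$ and whose edges are its transitions, every state is reachable from every state. Then infinitely many indices $n\geq 1$ are such that $A$ accepts the prefix $a_1\cdots a_{n-1}$, and the right-infinite subsequence $A[\alpha]=b_1b_2\cdots$ of $\alpha$ consisting of the symbols $a_n$ for these $n$, in increasing order of $n$, is $p$-distributed: for every non-empty finite word $w=w_1\cdots w_m$ over $\{0,1\}$, $$\lim_{N\to\infty}\frac{\left|\{1\le j\le N-m+1 : b_jb_{j+1}\cdots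 b_{j+m-1}=w\}\right|}{N}=\mu_p(w).$$ -/

import Mathlib

open Filter Topology

/-- A Bernoulli distribution on the alphabet `{0,1}`: values in `[0,1]` that sum to `1`. -/
def IsBernoulliDistribution (p : Fin 2 → ℝ) : Prop :=
  (∀ a, p a ∈ Set.Icc (0 : ℝ) 1) ∧ ∑ a, p a = 1

/-- The distribution is positive: both letters have positive probability. -/
def IsPositiveDistribution (p : Fin 2 → ℝ) : Prop :=
  ∀ a, 0 < p a

/-- The probability `μ_p(a₁ ⋯ aₙ) = p(a₁) ⋯ p(aₙ)` of a finite word. -/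
noncomputable def wordProb (p : Fin 2 → ℝ) (w : List (Fin 2)) : ℝ :=
  (w.map p).prod

/-- The finite word `α|_{≤ N}` of the first `N` letters of `α`. Sequences are indexed from `0`, so
the letters of this word are `α 0, …, α (N - 1)`. -/
def seqPrefix (α : ℕ → Fin 2) (N : ℕ) : List (Fin 2) :=
  (List.range N).map α

/-- The number of (possibly overlapping) occurrences of the non-empty word `a` in the word `b`:
the number of positions of `b` at which a copy of `a` starts. -/
def countOccurrences (a b : List (Fin 2)) : ℕ :=
  ((Finset.range b.length).filter fun j => a <+: b.drop j).card

/-- `α` is `p`-distributed: every non-empty word `a` occurs in `α` with limiting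
frequency `μ_p(a)`. -/
def IsDistributed (p : Fin 2 → ℝ) (α : ℕ → Fin 2) : Prop :=
  ∀ a : List (Fin 2), a ≠ [] →
    Tendsto (fun N : ℕ => (countOccurrences a (seqPrefix α N) : ℝ) / (N : ℝ)) atTop
      (𝓝 (wordProb p a))

/-- The block number `r` (counted from `0`) in the decomposition of `α` into consecutive,
non-overlapping blocks of length `n`. -/
def seqBlock (α : ℕ → Fin 2) (n r : ℕ) : List (Fin 2) :=
  (List.range n).map fun i => α (n * r + i)

/-- `α` is `p`-block-distributed: for every `n ≥ 1`, every word `w` of length `n` occurs in the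
sequence of `n`-blocks of `α` with limiting frequency `μ_p(w)`. -/
def IsBlockDistributed (p : Fin 2 → ℝ) (α : ℕ → Fin 2) : Prop :=
  ∀ n : ℕ, 1 ≤ n → ∀ w : List (Fin 2), w.length = n →
    Tendsto
      (fun k : ℕ => (((Finset.range k).filter fun r => seqBlock α n r = w).card : ℝ) / (k : ℝ))
      atTop (𝓝 (wordProb p w))

/-- The underlying directed graph of a DFA over `{0,1}`: states are nodes, transitions are
edges. -/
def DFAEdge {Q : Type*} (A : DFA (Fin 2) Q) (s t : Q) : Prop :=
  ∃ a : Fin 2, A.step s a = t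

/-- The underlying directed graph is strongly connected: every state can be reached from every
state by a (possibly empty) directed path. -/
def IsStronglyConnectedDFA {Q : Type*} (A : DFA (Fin 2) Q) : Prop :=
  ∀ s t : Q, Relation.ReflTransGen (DFAEdge A) s t

/-- The letter `α n` is picked out by `A`: the word of all letters before it is accepted. -/
def IsSelectedIndex {Q : Type*} (A : DFA (Fin 2) Q) (α : ℕ → Fin 2) (n : ℕ) : Prop :=
  seqPrefix α n ∈ A.accepts

/-- The subsequence `A[α]` of the picked out letters, in their order in `α`. It is meaningful as a
right-infinite sequence when infinitely many letters are picked out. -/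
noncomputable def selectedSeq {Q : Type*} (A : DFA (Fin 2) Q) (α : ℕ → Fin 2) : ℕ → Fin 2 :=
  fun k => α (Nat.nth (IsSelectedIndex A α) k)

/-! Fix a word `u` and a letter `a`. Whenever `A` selects the coming letter and the last selected
letters spell `u`, add the indicator of that letter being `a`, minus `p a`. These increments depend
only on the letter read and on a finite memory (automaton state and recent selections), and have
mean zero for each memory content. For independent letters they are orthogonal, so over `N` letters
their sum has second moment at most `N`, whatever the starting memory. Block frequencies carry this
bound to `α`, and the sum over the first `n` letters is `o(n)` (`tendsto_sum_increments_div`).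

Strong connectivity yields one word that visits an accepting state from every state. It recurs in
`α` with positive frequency, so selected positions have positive lower density
(`exists_eventually_le_count`), and `o(n)` is also small against the number of selected letters.
Hence in `A[α]` the frequency of `ua` is `p a` times that of `u`, and induction on the word finishes
(`isDistributed_of_prediction`). -/

/-- The expectation of `f` on words of length `n` with independent `p`-distributed letters. -/
noncomputable def wordExpectation (p : Fin 2 → ℝ) : ℕ → (List (Fin 2) → ℝ) → ℝ
  | 0, f => f []
  | n + 1, f => ∑ b, p b * wordExpectation p n fun w => f (b :: w)

/-- The sum of the increments `d` along the run on a word from a given state. -/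
def runSum {S : Type*} (step : S → Fin 2 → S) (d : S → Fin 2 → ℝ) : S → List (Fin 2) → ℝ
  | _, [] => 0
  | q, b :: w => d q b + runSum step d (step q b) w

/-- The word of length `m` at position `j` of the sequence `b`. -/
def seqWindow (b : ℕ → Fin 2) (j m : ℕ) : List (Fin 2) :=
  (List.range m).map fun i => b (j + i)

/-! ### Expectation over independent letters -/

section Expectation

variable {p : Fin 2 → ℝ}

theorem wordExpectation_eq_sum (n : ℕ) (f : List (Fin 2) → ℝ) :
    wordExpectation p n f =
      ∑ v : Fin n → Fin 2, wordProb p (List.ofFn v) * f (List.ofFn v) := by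
  induction n generalizing f with
  | zero => simp [wordExpectation, wordProb]
  | succ n ih =>
    rw [← (Fin.consEquiv fun _ : Fin (n + 1) => Fin 2).sum_comp, Fintype.sum_prod_type]
    simp only [wordExpectation, ih, Finset.mul_sum]
    refine Finset.sum_congr rfl fun b _ => Finset.sum_congr rfl fun v _ => ?_
    simp [Fin.consEquiv, List.ofFn_succ, wordProb, mul_assoc]

theorem wordExpectation_add (n : ℕ) (f g : List (Fin 2) → ℝ) :
    wordExpectation p n (fun w => f w + g w) =
      wordExpectation p n f + wordExpectation p n g := by
  simp only [wordExpectation_eq_sum, mul_add, Finset.sum_add_distrib]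

theorem wordExpectation_const_mul (n : ℕ) (c : ℝ) (f : List (Fin 2) → ℝ) :
    wordExpectation p n (fun w => c * f w) = c * wordExpectation p n f := by
  simp only [wordExpectation_eq_sum, Finset.mul_sum]
  exact Finset.sum_congr rfl fun v _ => by ring

theorem wordExpectation_sum {ι : Type*} (s : Finset ι) (n : ℕ) (f : ι → List (Fin 2) → ℝ) :
    wordExpectation p n (fun w => ∑ i ∈ s, f i w) = ∑ i ∈ s, wordExpectation p n (f i) := by
  simp only [wordExpectation_eq_sum, Finset.mul_sum]
  exact Finset.sum_comm

theorem wordExpectation_const (hp : ∑ b, p b = 1) (n : ℕ) (c : ℝ) :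
    wordExpectation p n (fun _ => c) = c := by
  induction n with
  | zero => rfl
  | succ n ih => simp only [wordExpectation, ih, ← Finset.sum_mul, hp, one_mul]

end Expectation

/-! ### Moments of mean-zero sums along a run -/

section RunSum

variable {p : Fin 2 → ℝ} {S : Type*} {step : S → Fin 2 → S} {d : S → Fin 2 → ℝ}

/-- Condition on the first letter: its increment averages to zero, and the rest is a run from a new
state, covered by induction over all states. -/
theorem wordExpectation_runSum (hp : ∑ b, p b = 1) (hd : ∀ q, ∑ b, p b * d q b = 0)
    (n : ℕ) (q : S) : wordExpectation p n (runSum step d q) = 0 := by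
  induction n generalizing q with
  | zero => rfl
  | succ n ih =>
    simp only [wordExpectation, runSum, wordExpectation_add, wordExpectation_const hp]
    have h : ∀ b, wordExpectation p n (fun w => runSum step d (step q b) w) = 0 := fun b => ih _
    simp only [h, add_zero, hd]

/-- The increments are orthogonal, so the second moment grows at most linearly. -/
theorem wordExpectation_runSum_sq_le (hp : ∑ b, p b = 1) (hp0 : ∀ b, 0 ≤ p b)
    (hd : ∀ q, ∑ b, p b * d q b = 0) (hd1 : ∀ q b, |d q b| ≤ 1) (n : ℕ) (q : S) :
    wordExpectation p n (fun w => runSum step d q w ^ 2) ≤ n := by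
  induction n generalizing q with
  | zero => simp [wordExpectation, runSum]
  | succ n ih =>
    have key : ∀ b, wordExpectation p n (fun w => runSum step d q (b :: w) ^ 2) ≤ 1 + n := by
      intro b
      have e : (fun w => runSum step d q (b :: w) ^ 2) = fun w =>
          (d q b ^ 2 + 2 * d q b * runSum step d (step q b) w) +
            runSum step d (step q b) w ^ 2 := by
        funext w; simp only [runSum]; ring
      rw [e, wordExpectation_add, wordExpectation_add, wordExpectation_const hp,
        wordExpectation_const_mul]
      have h0 : wordExpectation p n (fun w => runSum step d (step q b) w) = 0 :=
        wordExpectation_runSum hp hd n _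
      rw [h0, mul_zero, add_zero]
      exact add_le_add ((sq_le_one_iff_abs_le_one _).2 (hd1 q b)) (ih _)
    calc wordExpectation p (n + 1) (fun w => runSum step d q w ^ 2)
        = ∑ b, p b * wordExpectation p n (fun w => runSum step d q (b :: w) ^ 2) := rfl
      _ ≤ ∑ b, p b * (1 + n) :=
          Finset.sum_le_sum fun b _ => mul_le_mul_of_nonneg_left (key b) (hp0 b)
      _ = ((n + 1 : ℕ) : ℝ) := by rw [← Finset.sum_mul, hp]; push_cast; ring

theorem sum_range_eq_runSum {α : ℕ → Fin 2} {s : ℕ → S} (hs : ∀ n, s (n + 1) = step (s n) (α n))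
    (n m : ℕ) :
    ∑ i ∈ Finset.range n, d (s (m + i)) (α (m + i)) = runSum step d (s m) (seqWindow α m n) := by
  induction n generalizing m with
  | zero => simp [seqWindow, runSum]
  | succ n ih =>
    have e : seqWindow α m (n + 1) = α m :: seqWindow α (m + 1) n := by
      simp [seqWindow, List.range_succ_eq_map, add_comm, add_left_comm]
    rw [e, runSum, Finset.sum_range_succ', ← hs, ← ih (m + 1), add_comm]
    simp only [add_zero, add_assoc, add_comm 1]

end RunSum

/-! ### Averaging along a block-distributed sequence -/

theorem tendsto_block_average {p : Fin 2 → ℝ} {α : ℕ → Fin 2} (hα : IsBlockDistributed p α)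
    {n : ℕ} (hn : 1 ≤ n) (f : List (Fin 2) → ℝ) :
    Tendsto (fun k : ℕ => (∑ r ∈ Finset.range k, f (seqBlock α n r)) / k) atTop
      (𝓝 (wordExpectation p n f)) := by
  have hb : ∀ r, seqBlock α n r = List.ofFn fun i : Fin n => α (n * r + i) := by
    intro r
    apply List.ext_getElem <;> simp [seqBlock]
  have e : ∀ k : ℕ, (∑ r ∈ Finset.range k, f (seqBlock α n r)) / k =
      ∑ v : Fin n → Fin 2,
        (((Finset.range k).filter fun r => seqBlock α n r = List.ofFn v).card : ℝ) / k *
          f (List.ofFn v) := by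
    intro k
    rw [← Finset.sum_fiberwise (Finset.range k) (fun r => fun i : Fin n => α (n * r + i)),
      Finset.sum_div]
    refine Finset.sum_congr rfl fun v _ => ?_
    have e1 : (Finset.range k).filter (fun r => seqBlock α n r = List.ofFn v) =
        (Finset.range k).filter (fun r => (fun i : Fin n => α (n * r + i)) = v) := by
      refine Finset.filter_congr fun r _ => ?_
      rw [hb, List.ofFn_injective.eq_iff]
    rw [e1, Finset.sum_congr rfl (g := fun _ => f (List.ofFn v)), Finset.sum_const, nsmul_eq_mul]
    · ring
    · intro r hr
      rw [hb, (Finset.mem_filter.1 hr).2]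
  simp only [e, wordExpectation_eq_sum]
  exact tendsto_finsetSum _ fun v _ => (hα n hn _ (by simp)).mul_const _

/-- Along a block-distributed sequence, increments with mean zero that depend on the letter read
and on a finite memory average out. -/
theorem tendsto_sum_increments_div {p : Fin 2 → ℝ} (hp : ∑ b, p b = 1) (hp0 : ∀ b, 0 ≤ p b)
    {α : ℕ → Fin 2} (hα : IsBlockDistributed p α) {S : Type*} [Finite S]
    {step : S → Fin 2 → S} {d : S → Fin 2 → ℝ} (hd : ∀ q, ∑ b, p b * d q b = 0)
    (hd1 : ∀ q b, |d q b| ≤ 1) {s : ℕ → S} (hs : ∀ n, s (n + 1) = step (s n) (α n)) :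
    Tendsto (fun n : ℕ => (∑ i ∈ Finset.range n, d (s i) (α i)) / n) atTop (𝓝 0) := by
  have := Fintype.ofFinite S
  rw [Metric.tendsto_atTop]
  intro ε₀ hε₀
  -- Three errors of size `ε * n` will arise: small blocks, large blocks, and the incomplete last
  -- block.
  obtain ⟨ε, hε, hε4⟩ : ∃ ε : ℝ, 0 < ε ∧ 3 * ε < ε₀ := ⟨ε₀ / 4, by linarith, by linarith⟩
  set X : ℕ → ℝ := fun n => ∑ i ∈ Finset.range n, d (s i) (α i) with hX
  set K : ℝ := (Fintype.card S : ℝ) with hK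
  obtain ⟨N, hN⟩ := exists_nat_gt (max 1 ((K + 1) / ε ^ 2))
  have hN1 : (1 : ℝ) < N := (le_max_left _ _).trans_lt hN
  have hN0 : (0 : ℝ) < N := by linarith
  have hN2 : K + 1 ≤ ε ^ 2 * N := by
    have := (le_max_right _ _).trans hN.le
    rw [div_le_iff₀ (by positivity)] at this
    linarith
  have hNn : 1 ≤ N := by exact_mod_cast hN1.le
  -- The state at the start of a block depends on the past, so the squares are summed over all
  -- starting states; this costs only the factor `K`.
  set f : List (Fin 2) → ℝ := fun w => ∑ q, runSum step d q w ^ 2 with hf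
  have hEf : wordExpectation p N f < (K + 1) * N := by
    rw [hf, wordExpectation_sum]
    calc _ ≤ ∑ q : S, (N : ℝ) :=
          Finset.sum_le_sum fun q _ => wordExpectation_runSum_sq_le hp hp0 hd hd1 N q
      _ = K * N := by simp [hK]
      _ < _ := by nlinarith
  obtain ⟨k₀, hk₀⟩ := eventually_atTop.1
    ((tendsto_block_average hα hNn f).eventually (gt_mem_nhds hEf))
  have hblock : ∀ k, |X (N * k)| ≤
      k * (ε * N) + (∑ r ∈ Finset.range k, f (seqBlock α N r)) / (ε * N) := by
    intro k
    induction k with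
    | zero => simp [hX]
    | succ k ih =>
      have e : X (N * (k + 1)) = X (N * k) + runSum step d (s (N * k)) (seqBlock α N k) := by
        have := sum_range_eq_runSum (d := d) hs N (N * k)
        rw [show seqBlock α N k = seqWindow α (N * k) N from rfl, ← this, hX, mul_add, mul_one]
        exact Finset.sum_range_add _ _ _
      set D := runSum step d (s (N * k)) (seqBlock α N k) with hD
      have h1 : D ^ 2 ≤ f (seqBlock α N k) :=
        Finset.single_le_sum (f := fun q => runSum step d q (seqBlock α N k) ^ 2)
          (fun q _ => sq_nonneg _) (Finset.mem_univ (s (N * k)))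
      have hεN : 0 < ε * N := by positivity
      -- With `t = ε * N`, this is `D ^ 2 - t * |D| + t ^ 2 ≥ 0`; it turns the second-moment bound
      -- into a bound on absolute values.
      have h2 : |D| ≤ ε * N + D ^ 2 / (ε * N) := by
        rw [← sq_abs D, ← sub_le_iff_le_add', le_div_iff₀ hεN]
        nlinarith [sq_nonneg (|D| - ε * N), abs_nonneg D]
      have h3 : D ^ 2 / (ε * N) ≤ f (seqBlock α N k) / (ε * N) := by gcongr
      rw [e, Finset.sum_range_succ, add_div]
      push_cast
      linarith [abs_add_le (X (N * k)) D]
  obtain ⟨n₁, hn₁⟩ := exists_nat_gt (N / ε)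
  refine ⟨max (N * (k₀ + 1)) (n₁ + 1), fun n hn => ?_⟩
  have hna : N * (k₀ + 1) ≤ n := (le_max_left _ _).trans hn
  have hnb : n₁ + 1 ≤ n := (le_max_right _ _).trans hn
  have hk : k₀ + 1 ≤ n / N := (Nat.le_div_iff_mul_le hNn).2 (by linarith)
  set k := n / N with hkdef
  have hkpos : (0 : ℝ) < k := by exact_mod_cast (by omega : 0 < k)
  have hnk : n = N * k + n % N := (Nat.div_add_mod n N).symm
  have hnk' : (N : ℝ) * k ≤ n := by exact_mod_cast Nat.mul_div_le n N
  have hmod : ((n % N : ℕ) : ℝ) ≤ N := by exact_mod_cast (Nat.mod_lt n hNn).le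
  have hn0 : (0 : ℝ) < n := by exact_mod_cast (by omega : 0 < n)
  have hNn' : (N : ℝ) ≤ ε * n := by
    have : (n₁ : ℝ) ≤ n := by exact_mod_cast (by omega : n₁ ≤ n)
    rw [div_lt_iff₀ hε] at hn₁
    nlinarith
  have hXn : |X n| ≤ |X (N * k)| + N := by
    have e : X n = X (N * k) + ∑ i ∈ Finset.range (n % N), d (s (N * k + i)) (α (N * k + i)) := by
      conv_lhs => rw [hnk]
      exact Finset.sum_range_add _ _ _
    have h1 : |∑ i ∈ Finset.range (n % N), d (s (N * k + i)) (α (N * k + i))| ≤ (n % N : ℕ) := by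
      refine (Finset.abs_sum_le_sum_abs _ _).trans ?_
      refine (Finset.sum_le_sum fun i _ => hd1 _ _).trans ?_
      simp
    rw [e]
    linarith [abs_add_le (X (N * k)) (∑ i ∈ Finset.range (n % N), d (s (N * k + i)) (α (N * k + i)))]
  have havg : ∑ r ∈ Finset.range k, f (seqBlock α N r) ≤ (K + 1) * N * k := by
    have := hk₀ k (by omega)
    rw [div_lt_iff₀ hkpos] at this
    exact this.le
  -- The choice of `N` enters here: second moments grow like `N`, while `N ^ 2` would be needed for
  -- a linear drift.
  have h4 : (∑ r ∈ Finset.range k, f (seqBlock α N r)) / (ε * N) ≤ ε * n := by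
    rw [div_le_iff₀ (by positivity)]
    calc _ ≤ (K + 1) * N * k := havg
      _ ≤ (ε ^ 2 * N) * n := by
        rw [mul_assoc]
        exact mul_le_mul hN2 hnk' (by positivity) (by positivity)
      _ = ε * n * (ε * N) := by ring
  have h5 : (k : ℝ) * (ε * N) ≤ ε * n := by nlinarith
  rw [Real.dist_eq, sub_zero, abs_div, Nat.abs_cast, div_lt_iff₀ hn0]
  have := hblock k
  change |X n| < ε₀ * n
  nlinarith

/-! ### Positive density of the selected positions -/

section Automaton

variable {Q : Type*} {A : DFA (Fin 2) Q}

theorem exists_evalFrom_of_reflTransGen {s t : Q} (h : Relation.ReflTransGen (DFAEdge A) s t) :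
    ∃ y, A.evalFrom s y = t := by
  induction h with
  | refl => exact ⟨[], rfl⟩
  | tail _ hbc ih =>
    obtain ⟨y, rfl⟩ := ih
    obtain ⟨a, rfl⟩ := hbc
    exact ⟨y ++ [a], by simp⟩

/-- Some word leads through an accepting state from every state of a strongly connected DFA. -/
theorem exists_word_visiting_accept [Finite Q] (hA : IsStronglyConnectedDFA A)
    (hF : A.accept.Nonempty) :
    ∃ v : List (Fin 2), ∀ q, ∃ x, x <+: v ∧ A.evalFrom q x ∈ A.accept := by
  classical
  have := Fintype.ofFinite Q
  suffices h : ∀ T : Finset Q, ∃ v : List (Fin 2), ∀ q ∈ T, ∃ x, x <+: v ∧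
      A.evalFrom q x ∈ A.accept by
    obtain ⟨v, hv⟩ := h Finset.univ
    exact ⟨v, fun q => hv q (Finset.mem_univ q)⟩
  intro T
  induction T using Finset.induction_on with
  | empty => exact ⟨[], by simp⟩
  | insert q T _ ih =>
    obtain ⟨v, hv⟩ := ih
    obtain ⟨t, ht⟩ := hF
    obtain ⟨y, hy⟩ := exists_evalFrom_of_reflTransGen (hA (A.evalFrom q v) t)
    -- Extending `v` keeps the visits already secured for `T`; the extension `y` leads `q`, wherever
    -- `v` has taken it, to `t`.
    refine ⟨v ++ y, fun q' hq' => ?_⟩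
    rcases Finset.mem_insert.1 hq' with rfl | hq'
    · exact ⟨v ++ y, List.prefix_rfl, by rwa [DFA.evalFrom_of_append, hy]⟩
    · obtain ⟨x, hx, hx'⟩ := hv q' hq'
      exact ⟨x, hx.trans (List.prefix_append _ _), hx'⟩

theorem seqPrefix_succ (α : ℕ → Fin 2) (n : ℕ) : seqPrefix α (n + 1) = seqPrefix α n ++ [α n] := by
  simp [seqPrefix, List.range_succ]

theorem seqPrefix_add (α : ℕ → Fin 2) (j m : ℕ) :
    seqPrefix α (j + m) = seqPrefix α j ++ seqWindow α j m := by
  simp [seqPrefix, seqWindow, List.range_add]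

theorem wordProb_pos {p : Fin 2 → ℝ} (hpos : IsPositiveDistribution p) (w : List (Fin 2)) :
    0 < wordProb p w :=
  List.prod_pos fun x hx => by
    obtain ⟨a, -, rfl⟩ := List.mem_map.1 hx
    exact hpos a

open Classical in
/-- The selected indices have positive lower density. -/
theorem exists_eventually_le_count [Finite Q] {p : Fin 2 → ℝ} (hpos : IsPositiveDistribution p)
    {α : ℕ → Fin 2} (hα : IsBlockDistributed p α) (hA : IsStronglyConnectedDFA A)
    (hF : A.accept.Nonempty) :
    ∃ c : ℝ, 0 < c ∧ ∀ᶠ n : ℕ in atTop, c * n ≤ Nat.count (IsSelectedIndex A α) n := by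
  obtain ⟨v, hv⟩ := exists_word_visiting_accept hA hF
  set L := v.length + 1 with hL
  -- The visit may occur only after all of `v`; the extra letter, whose value is immaterial, keeps
  -- the selected position inside the block.
  set u : List (Fin 2) := v ++ [0] with hu
  have hcount : ∀ k, ((Finset.range k).filter fun r => seqBlock α L r = u).card ≤
      Nat.count (IsSelectedIndex A α) (L * k) := by
    intro k
    induction k with
    | zero => simp
    | succ k ih =>
      rw [Finset.range_add_one, Finset.filter_insert]
      split_ifs with h
      · rw [Finset.card_insert_of_notMem (by simp)]
        refine Nat.succ_le_of_lt (ih.trans_lt ?_)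
        obtain ⟨x, hx, hxa⟩ := hv (A.eval (seqPrefix α (L * k)))
        have hxl : x.length < L := Nat.lt_succ_of_le hx.length_le
        have hx2 : x = seqWindow α (L * k) x.length := by
          have h1 : x <+: seqBlock α L k := by
            rw [h]; exact hx.trans (List.prefix_append _ _)
          rw [List.prefix_iff_eq_take] at h1
          conv_lhs => rw [h1]
          simp [seqBlock, seqWindow, ← List.map_take, List.take_range, hxl.le]
        have hsel : IsSelectedIndex A α (L * k + x.length) := by
          change A.eval _ ∈ A.accept
          rw [seqPrefix_add, ← hx2, DFA.eval, DFA.evalFrom_of_append]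
          exact hxa
        refine (Nat.count_monotone _ (Nat.le_add_right _ x.length)).trans_lt
          (Nat.count_strict_mono hsel ?_)
        rw [mul_add, mul_one]; omega
      · exact ih.trans (Nat.count_monotone _ (Nat.mul_le_mul_left _ (Nat.le_succ k)))
  have hμ := wordProb_pos hpos u
  set μ := wordProb p u with hμd
  have hL0 : (0 : ℝ) < L := by positivity
  -- One factor 2 comes from bounding the frequency of `u` below by `μ / 2`, the other from `n ≤ 2 *
  -- L * k`.
  refine ⟨μ / (4 * L), by positivity, ?_⟩
  have hlim := (hα L (by omega) u (by simp [hu, hL])).eventually (lt_mem_nhds (half_lt_self hμ))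
  obtain ⟨k₀, hk₀⟩ := eventually_atTop.1 hlim
  filter_upwards [eventually_ge_atTop (L * (k₀ + 1))] with n hn
  have hk : k₀ + 1 ≤ n / L := (Nat.le_div_iff_mul_le (by omega)).2 (by linarith)
  set k := n / L with hkdef
  have hkpos : (1 : ℝ) ≤ k := by exact_mod_cast (by omega : 1 ≤ k)
  have h1 := hk₀ k (by omega)
  rw [lt_div_iff₀ (by linarith)] at h1
  have h2 : ((Nat.count (IsSelectedIndex A α) (L * k) : ℕ) : ℝ) ≤
      Nat.count (IsSelectedIndex A α) n := by
    exact_mod_cast Nat.count_monotone _ (Nat.mul_div_le n L)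
  have h3 : (((Finset.range k).filter fun r => seqBlock α L r = u).card : ℝ) ≤
      Nat.count (IsSelectedIndex A α) (L * k) := by exact_mod_cast hcount k
  have h4 : (n : ℝ) ≤ 2 * L * k := by
    have : n < L * k + L := by
      have := Nat.div_add_mod n L
      have := Nat.mod_lt n (by omega : L > 0)
      rw [← hkdef] at *
      omega
    have : (n : ℝ) ≤ L * k + L := by exact_mod_cast this.le
    nlinarith
  have h5 : μ / (4 * L) * n ≤ μ / 2 * k := by
    rw [div_mul_eq_mul_div, div_le_iff₀ (by positivity)]
    nlinarith
  linarith

end Automaton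

/-! ### Word frequencies from next-letter frequencies -/

section Words

variable {b : ℕ → Fin 2}

theorem seqWindow_succ (b : ℕ → Fin 2) (j m : ℕ) :
    seqWindow b j (m + 1) = seqWindow b j m ++ [b (j + m)] := by
  simp [seqWindow, List.range_succ]

theorem take_reverse_seqPrefix (b : ℕ → Fin 2) (j m : ℕ) :
    (seqPrefix b (m + j)).reverse.take m = (seqWindow b j m).reverse := by
  rw [add_comm, seqPrefix_add, List.reverse_append, List.take_left' (by simp [seqWindow])]

theorem isPrefix_drop_seqPrefix {u : List (Fin 2)} (hu : u ≠ []) (b : ℕ → Fin 2) (j N : ℕ) :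
    u <+: (seqPrefix b N).drop j ↔ j + u.length ≤ N ∧ seqWindow b j u.length = u := by
  have hpos := List.length_pos_iff.2 hu
  constructor
  · intro h
    have h1 := h.length_le
    have hle : j + u.length ≤ N := by simp [seqPrefix] at h1; omega
    refine ⟨hle, ?_⟩
    rw [List.prefix_iff_eq_take] at h
    conv_rhs => rw [h]
    apply List.ext_getElem
    · simp [seqWindow, seqPrefix]; omega
    · simp [seqWindow, seqPrefix]
  · rintro ⟨hle, h⟩
    obtain ⟨e, rfl⟩ := Nat.exists_eq_add_of_le hle
    rw [add_assoc, seqPrefix_add, List.drop_left' (by simp [seqPrefix])]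
    conv_lhs => rw [← h]
    simp only [seqWindow, List.range_add, List.map_append]
    exact List.prefix_append _ _

/-- The number of positions `j < N` of the sequence `b` at which a copy of `u` starts. -/
def windowCount (b : ℕ → Fin 2) (u : List (Fin 2)) (N : ℕ) : ℕ :=
  ((Finset.range N).filter fun j => seqWindow b j u.length = u).card

theorem countOccurrences_seqPrefix {u : List (Fin 2)} (hu : u ≠ []) (b : ℕ → Fin 2) (N : ℕ) :
    countOccurrences u (seqPrefix b (N + u.length)) = windowCount b u (N + 1) := by
  have hpos := List.length_pos_iff.2 hu
  unfold countOccurrences windowCount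
  congr 1
  ext j
  simp only [Finset.mem_filter, Finset.mem_range, isPrefix_drop_seqPrefix hu]
  simp only [seqPrefix, List.length_map, List.length_range]
  constructor
  · rintro ⟨_, h, h'⟩; exact ⟨by omega, h'⟩
  · rintro ⟨h, h'⟩; exact ⟨by omega, by omega, h'⟩

/-- Counting by starting position differs from counting inside a prefix only by boundary effects,
namely a ratio `(N + 1) / (N + u.length)` tending to 1. It also gives the empty word frequency 1,
which starts the induction on words. -/
theorem isDistributed_of_tendsto_windowCount {p : Fin 2 → ℝ}
    (h : ∀ u, Tendsto (fun N : ℕ => (windowCount b u N : ℝ) / N) atTop (𝓝 (wordProb p u))) :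
    IsDistributed p b := by
  intro u hu
  rw [← tendsto_add_atTop_iff_nat u.length]
  simp only [countOccurrences_seqPrefix hu]
  have h1 := (tendsto_add_atTop_iff_nat 1).2 (h u)
  have h2 : Tendsto (fun N : ℕ => ((N + 1 : ℕ) : ℝ) / ((N + u.length : ℕ) : ℝ)) atTop (𝓝 1) := by
    have := tendsto_add_mul_div_add_mul_atTop_nhds (1 : ℝ) (u.length : ℝ) 1 (d := 1) one_ne_zero
    simp only [one_mul, div_one] at this
    refine this.congr fun N => ?_
    push_cast
    rw [add_comm (1 : ℝ), add_comm (u.length : ℝ)]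
  have h3 := h1.mul h2
  rw [mul_one] at h3
  refine h3.congr fun N => ?_
  have : ((N + 1 : ℕ) : ℝ) ≠ 0 := by positivity
  field_simp

/-- A sequence is `p`-distributed if after each word the next letter has the right frequency. -/
theorem isDistributed_of_prediction {p : Fin 2 → ℝ}
    (h : ∀ (u : List (Fin 2)) (a : Fin 2),
      Tendsto (fun N : ℕ => (∑ j ∈ Finset.range N,
        if (seqPrefix b j).reverse.take u.length = u.reverse
          then (if b j = a then 1 else 0) - p a else 0) / (N : ℝ)) atTop (𝓝 0)) :
    IsDistributed p b := by
  refine isDistributed_of_tendsto_windowCount fun u => ?_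
  induction u using List.reverseRecOn with
  | nil =>
    refine (tendsto_const_nhds (x := (1 : ℝ))).congr' ?_ |>.trans (by simp [wordProb])
    filter_upwards [eventually_gt_atTop 0] with N hN
    have : (N : ℝ) ≠ 0 := by positivity
    simp [windowCount, seqWindow, this]
  | append_singleton u a ih =>
    set m := u.length with hm
    set g : ℕ → ℝ := fun j => if (seqPrefix b j).reverse.take u.length = u.reverse
          then (if b j = a then 1 else 0) - p a else 0 with hg
    -- Before `m` letters are available, the truncated list is too short to equal `u.reverse`.
    have hsmall : ∀ j ∈ Finset.range m, g j = 0 := by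
      intro j hj
      rw [Finset.mem_range] at hj
      refine if_neg fun h => ?_
      have := congrArg List.length h
      simp [seqPrefix] at this
      omega
    have hlarge : ∀ j, g (m + j) = (if seqWindow b j (u ++ [a]).length = u ++ [a] then 1 else 0) -
        p a * (if seqWindow b j u.length = u then 1 else 0) := by
      intro j
      simp only [hg, ← hm, take_reverse_seqPrefix, List.reverse_inj, List.length_append,
        List.length_singleton, seqWindow_succ]
      by_cases hw : seqWindow b j m = u
      · simp [hw, add_comm]
      · have hw' : seqWindow b j m ++ [b (j + m)] ≠ u ++ [a] := fun h =>
          hw (List.append_inj_left' h rfl)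
        simp [hw, hw']
    -- An occurrence of `u` at `j` is followed by its predicted letter at `m + j`, hence the sum up
    -- to `N + m`.
    have hsum : ∀ N, (windowCount b (u ++ [a]) N : ℝ) =
        ∑ j ∈ Finset.range (N + m), g j + p a * windowCount b u N := by
      intro N
      rw [add_comm N m, Finset.sum_range_add, Finset.sum_eq_zero hsmall]
      simp only [hlarge, windowCount, Finset.card_filter, Finset.sum_sub_distrib, ← Finset.mul_sum]
      push_cast
      ring
    have h1 := (tendsto_add_atTop_iff_nat m).2 (h u a)
    have h2 : Tendsto (fun N : ℕ => ((N + m : ℕ) : ℝ) / (N : ℝ)) atTop (𝓝 1) := by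
      have := tendsto_add_mul_div_add_mul_atTop_nhds (m : ℝ) 0 1 (d := 1) one_ne_zero
      simp only [one_mul, div_one, zero_add] at this
      refine this.congr fun N => ?_
      push_cast
      rw [add_comm]
    have h3 := (h1.mul h2).add (ih.const_mul (p a))
    have e : wordProb p (u ++ [a]) = 0 * 1 + p a * wordProb p u := by
      simp [wordProb, mul_comm]
    rw [e]
    refine h3.congr' ?_
    filter_upwards [eventually_gt_atTop 0] with N hN
    have hN0 : (N : ℝ) ≠ 0 := by positivity
    have hNm : ((N + m : ℕ) : ℝ) ≠ 0 := by positivity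
    rw [hsum]
    change (∑ j ∈ Finset.range (N + m), g j) / _ * _ + _ = _
    field_simp

end Words

/-! ### The selected subsequence as a finite-memory process -/

/-- The automaton state together with the last `m` selected letters, after reading `n` letters. -/
noncomputable def memoryState {Q : Type*} (A : DFA (Fin 2) Q) (α : ℕ → Fin 2) (m : ℕ) (n : ℕ) :
    Q × {l : List (Fin 2) // l.length ≤ m} :=
  open Classical in
  (A.eval (seqPrefix α n),
    ⟨(seqPrefix (selectedSeq A α) (Nat.count (IsSelectedIndex A α) n)).reverse.take m,
      List.length_take_le _ _⟩)

open Classical in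
/-- The transition function of `memoryState`. -/
noncomputable def memoryStep {Q : Type*} (A : DFA (Fin 2) Q) (m : ℕ)
    (s : Q × {l : List (Fin 2) // l.length ≤ m}) (a : Fin 2) :
    Q × {l : List (Fin 2) // l.length ≤ m} :=
  (A.step s.1 a,
    if s.1 ∈ A.accept then ⟨(a :: s.2.1).take m, List.length_take_le _ _⟩ else s.2)

section Selection

variable {Q : Type*} (A : DFA (Fin 2) Q) (α : ℕ → Fin 2)

open Classical in
theorem selectedSeq_count {n : ℕ} (h : IsSelectedIndex A α n) :
    selectedSeq A α (Nat.count (IsSelectedIndex A α) n) = α n := by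
  rw [selectedSeq, Nat.nth_count h]

/-- Storing the letters newest first makes an update a push followed by a truncation, and truncating
before the push as well changes nothing. So the bounded memory determines its own evolution. -/
theorem memoryState_succ (m n : ℕ) :
    memoryState A α m (n + 1) = memoryStep A m (memoryState A α m n) (α n) := by
  classical
  by_cases h : IsSelectedIndex A α n
  · rw [memoryStep, if_pos (show (memoryState A α m n).1 ∈ A.accept from h)]
    refine Prod.ext (by simp [memoryState, seqPrefix_succ, DFA.eval]) (Subtype.ext ?_)
    simp only [memoryState, Nat.count_succ, if_pos h, seqPrefix_succ, selectedSeq_count A α h]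
    cases m <;> simp [List.take_take]
  · rw [memoryStep, if_neg (show (memoryState A α m n).1 ∉ A.accept from h)]
    refine Prod.ext (by simp [memoryState, seqPrefix_succ, DFA.eval]) (Subtype.ext ?_)
    simp only [memoryState, Nat.count_succ, if_neg h, add_zero]

open Classical in
-- At a selected position, `Nat.count` is the index of its letter in the subsequence; this converts
-- sums over time in `α` into sums over `A[α]`.
theorem sum_selected_eq (f : ℕ → Fin 2 → ℝ) (n : ℕ) :
    (∑ i ∈ Finset.range n, if IsSelectedIndex A α i then
      f (Nat.count (IsSelectedIndex A α) i) (α i) else 0) =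
    ∑ j ∈ Finset.range (Nat.count (IsSelectedIndex A α) n), f j (selectedSeq A α j) := by
  induction n with
  | zero => simp
  | succ n ih =>
    rw [Finset.sum_range_succ, ih, Nat.count_succ]
    split_ifs with h
    · rw [Finset.sum_range_succ, selectedSeq_count A α h]
    · simp

end Selection

theorem mainTheorem1 {Q : Type*} [Finite Q] (p : Fin 2 → ℝ)
    (hp : IsBernoulliDistribution p) (hpos : IsPositiveDistribution p)
    (α : ℕ → Fin 2) (hα : IsBlockDistributed p α)
    (A : DFA (Fin 2) Q) (hA : IsStronglyConnectedDFA A) (hF : A.accept.Nonempty) :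
    {n : ℕ | IsSelectedIndex A α n}.Infinite ∧ IsDistributed p (selectedSeq A α) := by
  classical
  obtain ⟨c, hc, hcount⟩ := exists_eventually_le_count hpos hα hA hF
  have hinf : {n : ℕ | IsSelectedIndex A α n}.Infinite := by
    intro hfin
    -- Beyond `C` the linear lower bound exceeds the total number of selected indices.
    obtain ⟨C, hC⟩ := exists_nat_gt ((hfin.toFinset.card : ℝ) / c)
    obtain ⟨n, hn, hCn⟩ := (hcount.and (eventually_ge_atTop C)).exists
    have h1 : Nat.count (IsSelectedIndex A α) n ≤ hfin.toFinset.card := by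
      rw [Nat.count_eq_card_filter_range]
      exact Finset.card_le_card fun i hi => by simpa using (Finset.mem_filter.1 hi).2
    have h2 : ((Nat.count (IsSelectedIndex A α) n : ℕ) : ℝ) ≤ hfin.toFinset.card := by
      exact_mod_cast h1
    rw [div_lt_iff₀ hc] at hC
    have h3 : (C : ℝ) ≤ n := by exact_mod_cast hCn
    nlinarith
  refine ⟨hinf, isDistributed_of_prediction fun u a => ?_⟩
  set m := u.length with hm
  have hfinite : Finite {l : List (Fin 2) // l.length ≤ m} :=
    (List.finite_length_le (Fin 2) m).to_subtype
  set e : Fin 2 → ℝ := fun b => (if b = a then 1 else 0) - p a with he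
  -- Whether the increment is active is decided by the memory before the letter is read, so the mean
  -- is zero for every memory content.
  set d : Q × {l : List (Fin 2) // l.length ≤ m} → Fin 2 → ℝ := fun s b =>
    if s.1 ∈ A.accept then (if s.2.1 = u.reverse then e b else 0) else 0 with hd
  have he0 : ∑ b, p b * e b = 0 := by
    simp only [he, mul_sub, Finset.sum_sub_distrib, ← Finset.sum_mul, hp.2]
    simp
  have he1 : ∀ b, |e b| ≤ 1 := by
    intro b
    obtain ⟨h0, h1⟩ := hp.1 a
    rw [abs_le]
    simp only [he]
    split_ifs <;> constructor <;> linarith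
  have hd0 : ∀ s, ∑ b, p b * d s b = 0 := by
    intro s
    simp only [hd]
    split_ifs
    · exact he0
    · simp
    · simp
  have hd1 : ∀ s b, |d s b| ≤ 1 := by
    intro s b
    simp only [hd]
    split_ifs
    · exact he1 b
    · simp
    · simp
  have hlim := tendsto_sum_increments_div hp.2 (fun b => (hpos b).le) hα hd0 hd1
    (memoryState_succ A α m)
  set f : ℕ → Fin 2 → ℝ := fun j b =>
    if (seqPrefix (selectedSeq A α) j).reverse.take m = u.reverse then e b else 0 with hf
  have hsum : ∀ n, ∑ i ∈ Finset.range n, d (memoryState A α m i) (α i) =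
      ∑ j ∈ Finset.range (Nat.count (IsSelectedIndex A α) n), f j (selectedSeq A α j) := by
    intro n
    rw [← sum_selected_eq]
    rfl
  have hnth : Tendsto (Nat.nth (IsSelectedIndex A α)) atTop atTop :=
    (Nat.nth_strictMono hinf).tendsto_atTop
  -- Evaluate at `n = Nat.nth _ N`, where exactly `N` letters have been selected. The density bound
  -- gives `c * n ≤ N`, so dividing by `N` instead of `n` costs at most the factor `c⁻¹`.
  have h1 := (hlim.comp hnth).abs.const_mul c⁻¹
  rw [abs_zero, mul_zero] at h1
  refine squeeze_zero_norm' ?_ h1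
  filter_upwards [hnth.eventually hcount, eventually_gt_atTop 0] with N hN hN0
  rw [Nat.count_nth_of_infinite hinf] at hN
  simp only [Function.comp_apply, hsum, Nat.count_nth_of_infinite hinf]
  rw [Real.norm_eq_abs, abs_div, abs_div, Nat.abs_cast, Nat.abs_cast]
  have hN0' : (0 : ℝ) < N := by exact_mod_cast hN0
  have hn0 : (0 : ℝ) < Nat.nth (IsSelectedIndex A α) N := by
    exact_mod_cast hN0.trans_le ((Nat.nth_strictMono hinf).le_apply)
  rw [← div_eq_inv_mul, div_div, mul_comm _ c]
  exact div_le_div_of_nonneg_left (abs_nonneg _) (by positivity) hN
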